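/- All spaces and topological groups are Tychonoff. Let $G$ be a topological group acting continuously on a space $X$ by an action $\alpha$. Assume that either $X$ is a coset space of $G$ (that is, $X$ is equivariantly homeomorphic to $G/K$ for a closed subgroup $K$, with the action by left translations), or $\alpha$ is transitive and $d$-open (that is, $x\in\operatorname{Int}(\operatorname{cl}(Ox))$ for all $x\in X$ and all neighborhoods $O$ of the unit of $G$). Let $\tau$ be an infinite cardinal. Terminology. $G$ is *$\tau$-balanced* if for every neighborhood $U$ of the unit there is a family $\gamma$ of at most $\tau$ neighborhoods of the unit such that for each $g\in G$ some $V\in\gamma$ satisfies $gVg^{-1}\subseteq U$; $G$ is *$\tau$-narrow* if for every neighborhood $U$ of the unit there is $F\subseteq G$ with $|F|\le\tau$ and $FU=G$. As usual, $\chi(X)$ is the character and $w(X)$ the weight of $X$, and the weight $w(\mathcal U)$ of a uniformity is the least cardinality of a base of it. An *equiuniformity* on $X$ is a uniformity $\mathcal U$, given by its uniform covers and compatible with the topology of $X$, that is saturated ($u\in\mathcal U$, $g\in G$ imply $gu=\{gA: A\in u\}\in\mathcal U$) and bounded (for every $u\in\mathcal U$ there are a neighborhood $O$ of the unit and $v\in\mathcal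 U$ such that $\{OV: V\in v\}$ refines $u$). An *equivariant extension* of $(G,X,\alpha)$ is a Tychonoff space $\tilde X$ with a continuous action $\tilde\alpha$ of $G$ and an equivariant topological embedding of $X$ onto a dense subspace of $\tilde X$; it is a *$G$-compactification* if $\tilde X$ is compact. A uniformity on $\tilde X$ *extends* $\mathcal U$ if it induces $\mathcal U$ on $X$ through the embedding. 1. If $G$ is $\tau$-balanced and $\chi(X)\le\tau$, then there is an equiuniformity $\mathcal U$ on $X$ with $w(\mathcal U)\le\tau$. 2. If $G$ is $\tau$-balanced and $w(X)\le\tau$, then there are an equiuniformity $\mathcal U$ on $X$ with $w(\mathcal U)\le\tau$, an equivariant extension $(G,\tilde X,\tilde\alpha)$ of $(G,X,\alpha)$ with $w(\tilde X)\le\tau$, and a complete equiuniformity $\tilde{\mathcal U}$ on $\tilde X$ with $w(\tilde{\mathcal U})\le\tau$ that extends $\mathcal U$. 3. If $G$ is $\omega$-balanced and $\chi(X)\le\aleph_0$, then there are an equiuniformity $\mathcal U$ on $X$ with $w(\mathcal U)\le\aleph_0$, an equivariant extension $(G,\tilde X,\tilde\alpha)$ of $(G,X,\alpha)$, and a complete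 metric on $\tilde X$, compatible with its topology, whose uniformity extends $\mathcal U$. 4. If $G$ is $\omega$-narrow and $\chi(X)\le\aleph_0$, then there are a totally bounded equiuniformity $\mathcal U$ on $X$ with $w(\mathcal U)\le\aleph_0$ and a $G$-compactification $(G,bX,\tilde\alpha)$ of $(G,X,\alpha)$ such that $bX$ is metrizable and the uniformity of the compactum $bX$ extends $\mathcal U$. -/

import Mathlib

open Set Topology Cardinal

universe u

namespace EquiUnif

/-! Cardinal invariants of topological spaces. -/

/-- The weight `w(X)`: the least cardinality of a base of the topology. -/
noncomputable def weight (X : Type u) [TopologicalSpace X] : Cardinal.{u} :=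
  sInf {κ | ∃ B : Set (Set X), TopologicalSpace.IsTopologicalBasis B ∧ #B = κ}

/-- The character `χ(x, X)`: the least cardinality of a base of neighborhoods at `x`. -/
noncomputable def characterAt {X : Type u} [TopologicalSpace X] (x : X) : Cardinal.{u} :=
  sInf {κ | ∃ B : Set (Set X), (𝓝 x).HasBasis (fun V => V ∈ B) id ∧ #B = κ}

/-- The character `χ(X)`: the supremum of the characters at the points of `X`. -/
noncomputable def character (X : Type u) [TopologicalSpace X] : Cardinal.{u} :=
  ⨆ x : X, characterAt x

/-! Classes of topological groups. -/

/-- `G` is `τ`-balanced (`inv(G) ≤ τ`): every neighborhood `U` of the unit has a subordinated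
family `γ` of at most `τ` neighborhoods of the unit, that is, for each `g` there is `V ∈ γ`
with `g V g⁻¹ ⊆ U`. -/
def IsBalanced (τ : Cardinal.{u}) (G : Type u) [Group G] [TopologicalSpace G] : Prop :=
  ∀ U ∈ 𝓝 (1 : G), ∃ γ : Set (Set G), #γ ≤ τ ∧ (∀ V ∈ γ, V ∈ 𝓝 (1 : G)) ∧
    ∀ g : G, ∃ V ∈ γ, ∀ h ∈ V, g * h * g⁻¹ ∈ U

/-- `G` is `τ`-narrow (`ib(G) ≤ τ`): for every neighborhood `U` of the unit there is a set `F`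
of at most `τ` elements with `F U = G`. -/
def IsNarrow (τ : Cardinal.{u}) (G : Type u) [Group G] [TopologicalSpace G] : Prop :=
  ∀ U ∈ 𝓝 (1 : G), ∃ F : Set G, #F ≤ τ ∧ ∀ g : G, ∃ f ∈ F, ∃ h ∈ U, f * h = g

/-! Actions. -/

/-- The action of `G` on `X` is `d`-open: `x ∈ Int (cl (O x))` for every point `x` and every
neighborhood `O` of the unit. -/
def IsDOpenAction (G X : Type u) [Group G] [TopologicalSpace G] [TopologicalSpace X]
    [MulAction G X] : Prop :=
  ∀ x : X, ∀ O ∈ 𝓝 (1 : G), x ∈ interior (closure ((fun g : G => g • x) '' O))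

/-- `X` with its action of `G` is a coset space of `G`: it is equivariantly homeomorphic to the
quotient space `G ⧸ K` by a closed subgroup `K`, with the action by left translations. -/
def IsCosetSpace (G X : Type u) [Group G] [TopologicalSpace G] [TopologicalSpace X]
    [MulAction G X] : Prop :=
  ∃ K : Subgroup G, IsClosed (K : Set G) ∧
    ∃ h : X ≃ₜ G ⧸ K, ∀ (g : G) (x : X), h (g • x) = g • h x

/-! Uniformities, described by their uniform covers. -/

/-- `v` refines `c`: every member of `v` lies in a member of `c`. -/
def Refines {X : Type u} (v c : Set (Set X)) : Prop :=
  ∀ V ∈ v, ∃ U ∈ c, V ⊆ U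

/-- The covers that belong to the uniformity `𝓤`: those refined by the cover by the balls
`{y | (x, y) ∈ E}` of some entourage `E`. -/
def IsUniformCover {X : Type u} (𝓤 : UniformSpace X) (c : Set (Set X)) : Prop :=
  ∃ E ∈ 𝓤.uniformity, ∀ x : X, ∃ U ∈ c, {y | (x, y) ∈ E} ⊆ U

/-- The weight `w(𝓤)`: the least cardinality of a base of the uniformity, that is, of a family of
uniform covers such that each uniform cover is refined by a member of it. -/
noncomputable def uniformWeight {X : Type u} (𝓤 : UniformSpace X) : Cardinal.{u} :=
  sInf {κ | ∃ B : Set (Set (Set X)), (∀ b ∈ B, IsUniformCover 𝓤 b) ∧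
    (∀ c, IsUniformCover 𝓤 c → ∃ b ∈ B, Refines b c) ∧ #B = κ}

/-- `𝓤` is an equiuniformity on the `G`-space `X`: a uniformity inducing the topology of `X`
which is saturated and bounded. -/
structure IsEquiuniformity (G : Type u) {X : Type u} [Group G] [TopologicalSpace G]
    [t : TopologicalSpace X] [MulAction G X] (𝓤 : UniformSpace X) : Prop where
  compatible : 𝓤.toTopologicalSpace = t
  saturated : ∀ (g : G) (c : Set (Set X)), IsUniformCover 𝓤 c →
    IsUniformCover 𝓤 ((fun V : Set X => (fun x => g • x) '' V) '' c)
  bounded : ∀ c : Set (Set X), IsUniformCover 𝓤 c →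
    ∃ O ∈ 𝓝 (1 : G), ∃ v : Set (Set X), IsUniformCover 𝓤 v ∧
      Refines ((fun V : Set X => Set.image2 (fun (g : G) (x : X) => g • x) O V) '' v) c

/-- An equivariant extension of the `G`-space `X`: a Tychonoff `G`-space `Y` (for the same group
`G`) with an equivariant embedding of `X` onto a dense subspace of `Y`. A compact one is a
`G`-compactification. -/
structure EquivariantExtension (G X : Type u) [Group G] [TopologicalSpace G]
    [TopologicalSpace X] [MulAction G X] where
  Y : Type u
  [top : TopologicalSpace Y]
  [t35 : T35Space Y]
  [act : MulAction G Y]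
  [cont : ContinuousSMul G Y]
  emb : X → Y
  isDenseEmbedding : IsDenseEmbedding emb
  map_smul : ∀ (g : G) (x : X), emb (g • x) = g • emb x

attribute [instance] EquivariantExtension.top EquivariantExtension.t35
  EquivariantExtension.act EquivariantExtension.cont

end EquiUnif

/-! In both cases the action is transitive and `d`-open (for a coset space the orbit maps are open).
For a neighborhood `O` of the unit take the entourage of pairs `(x, y)` with `y ∈ cl (O x)`.
Products in `G` control composition, `d`-openness gives symmetry and makes the balls neighborhoods,
conjugation in `G` controls translations, and boundedness is immediate.

To get weight at most `τ`, only a family `S` of at most `τ` neighborhoods is used. It contains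
enough of them to give a base at one point and is closed under symmetric roots and under the
subordinated families supplied by `τ`-balancedness. Transitivity carries the base at that point to
every other point (`exists_small_equiuniformity`).

The action extends to the completion, where the base keeps its size (`exists_complete_extension`,
`HasSmallBase.of_comap`). A countable base gives metrizability.

If `G` is `ω`-narrow, it is `ω`-balanced. The translates of a truncated distance to a point map `X`
into a cube and induce a totally bounded equiuniformity. By narrowness countably many translates
suffice, so its base is countable, and its completion is a metrizable compactum. -/

namespace EquiUnif

section

open Filter Uniformity Pointwise

/-! ### Bases of uniformities -/

/-- The uniformity has a base of at most `τ` entourages. -/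
def HasSmallBase (τ : Cardinal.{u}) {X : Type u} (𝔘 : UniformSpace X) : Prop :=
  ∃ S : Set (Set (X × X)), #S ≤ τ ∧ (∀ s ∈ S, s ∈ 𝔘.uniformity) ∧
    ∀ E ∈ 𝔘.uniformity, ∃ s ∈ S, s ⊆ E

/-- Every element of a neighborhood of the unit moves the points by less than a given entourage. -/
def IsBoundedAction (G : Type u) {X : Type u} [Group G] [TopologicalSpace G] [MulAction G X]
    (𝔘 : UniformSpace X) : Prop :=
  ∀ E ∈ 𝔘.uniformity, ∃ O ∈ 𝓝 (1 : G), ∀ g ∈ O, ∀ x : X, (x, g • x) ∈ E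

theorem HasSmallBase.uniformWeight_le {τ : Cardinal.{u}} {X : Type u} {𝔘 : UniformSpace X}
    (h : HasSmallBase τ 𝔘) : uniformWeight 𝔘 ≤ τ := by
  obtain ⟨S, hS, hmem, hbase⟩ := h
  let F : Set (X × X) → Set (Set X) := fun E => range fun x => {y | (x, y) ∈ E}
  have hle : uniformWeight 𝔘 ≤ #(F '' S) := by
    refine csInf_le' ⟨F '' S, ?_, ?_, rfl⟩
    · rintro _ ⟨E, hE, rfl⟩
      exact ⟨E, hmem E hE, fun x => ⟨_, ⟨x, rfl⟩, Subset.rfl⟩⟩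
    · rintro c ⟨E, hE, hc⟩
      obtain ⟨s, hs, hsE⟩ := hbase E hE
      refine ⟨_, ⟨s, hs, rfl⟩, ?_⟩
      rintro _ ⟨x, rfl⟩
      obtain ⟨U, hU, hxU⟩ := hc x
      exact ⟨U, hU, fun y hy => hxU (hsE hy)⟩
  exact hle.trans (mk_image_le.trans hS)

theorem HasSmallBase.of_isCountablyGenerated {X : Type u} [𝔘 : UniformSpace X]
    [IsCountablyGenerated (𝓤 X)] : HasSmallBase ℵ₀ 𝔘 := by
  obtain ⟨B, hB⟩ := (𝓤 X).exists_antitone_basis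
  refine ⟨range B, (countable_range B).le_aleph0, ?_, fun E hE => ?_⟩
  · rintro _ ⟨n, rfl⟩
    exact hB.1.mem_of_mem trivial
  · obtain ⟨n, -, hn⟩ := hB.1.mem_iff.1 hE
    exact ⟨_, ⟨n, rfl⟩, hn⟩

theorem HasSmallBase.isCountablyGenerated {X : Type u} [𝔘 : UniformSpace X]
    (h : HasSmallBase ℵ₀ 𝔘) : IsCountablyGenerated (𝓤 X) := by
  obtain ⟨S, hS, hmem, hbase⟩ := h
  have hb : (𝓤 X).HasBasis (· ∈ S) id :=
    ⟨fun E => ⟨fun hE => hbase E hE, fun ⟨s, hs, hsE⟩ => mem_of_superset (hmem s hs) hsE⟩⟩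
  exact HasCountableBasis.isCountablyGenerated ⟨hb, le_aleph0_iff_set_countable.1 hS⟩

theorem isEquiuniformity_of_uniformContinuous {G X : Type u} [Group G] [TopologicalSpace G]
    [t : TopologicalSpace X] [MulAction G X] (𝔘 : UniformSpace X)
    (ht : 𝔘.toTopologicalSpace = t)
    (huc : ∀ g : G, @UniformContinuous X X 𝔘 𝔘 (fun x => g • x))
    (hb : IsBoundedAction G 𝔘) : IsEquiuniformity G 𝔘 where
  compatible := ht
  saturated := by
    rintro g c ⟨E, hE, hc⟩
    -- The ball at `x` of the pullback of `E` under `g⁻¹` is `g` applied to the `E`-ball at `g⁻¹ •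
    -- x`.
    refine ⟨_, huc g⁻¹ hE, fun x => ?_⟩
    obtain ⟨U, hU, hxU⟩ := hc (g⁻¹ • x)
    refine ⟨_, ⟨U, hU, rfl⟩, fun y hy => ⟨g⁻¹ • y, hxU hy, ?_⟩⟩
    simp
  bounded := by
    rintro c ⟨E, hE, hc⟩
    obtain ⟨D, hD, hDE⟩ := @comp_mem_uniformity_sets X 𝔘 E hE
    obtain ⟨O, hO, hOD⟩ := hb D hD
    refine ⟨O, hO, range fun x => {y | (x, y) ∈ D}, ⟨D, hD, fun x => ⟨_, ⟨x, rfl⟩, Subset.rfl⟩⟩, ?_⟩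
    rintro _ ⟨_, ⟨x, rfl⟩, rfl⟩
    obtain ⟨U, hU, hxU⟩ := hc x
    refine ⟨U, hU, ?_⟩
    rintro _ ⟨g, hg, y, hy, rfl⟩
    exact hxU (hDE ⟨y, hy, hOD g hg y⟩)

/-! ### Dense embeddings -/

/-- Closures of the images of basic entourages form a base: an open entourage lies in the closure of
its trace on the dense image, and closed entourages are cofinal. -/
theorem HasSmallBase.of_comap {τ : Cardinal.{u}} {X Y : Type u} [𝔙 : UniformSpace Y] {e : X → Y}
    (he : DenseRange e) (h : HasSmallBase τ (𝔙.comap e)) : HasSmallBase τ 𝔙 := by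
  obtain ⟨S, hS, hmem, hbase⟩ := h
  have hd : DenseRange (Prod.map e e) := he.prodMap he
  refine ⟨(fun E => closure (Prod.map e e '' E)) '' S, mk_image_le.trans hS, ?_, fun W hW => ?_⟩
  · rintro _ ⟨E, hE, rfl⟩
    obtain ⟨V, hV, hVE⟩ := hmem E hE
    obtain ⟨V', ⟨hV', hVo⟩, hVV⟩ := uniformity_hasBasis_open.mem_iff.1 hV
    refine mem_of_superset hV' ?_
    refine (hd.open_subset_closure_inter hVo).trans (closure_mono ?_)
    rintro _ ⟨hp, ⟨p, rfl⟩⟩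
    exact ⟨p, hVE (hVV hp), rfl⟩
  · obtain ⟨W', ⟨hW', hWc⟩, hWW⟩ := uniformity_hasBasis_closed.mem_iff.1 hW
    obtain ⟨E, hE, hEW⟩ := hbase (Prod.map e e ⁻¹' W') ⟨W', hW', Subset.rfl⟩
    refine ⟨_, ⟨E, hE, rfl⟩, (closure_minimal ?_ hWc).trans hWW⟩
    rintro _ ⟨p, hp, rfl⟩
    exact hEW hp

theorem weight_le_of_denseRange {τ : Cardinal.{u}} (hτ : ℵ₀ ≤ τ) {D Y : Type u}
    [𝔙 : UniformSpace Y] (h : HasSmallBase τ 𝔙) (hD : #D ≤ τ) {e : D → Y} (he : DenseRange e) :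
    weight Y ≤ τ := by
  obtain ⟨S, hS, hmem, hbase⟩ := h
  let F : S × D → Set Y := fun p => interior {y | (e p.2, y) ∈ p.1.1}
  have hle : weight Y ≤ #(range F) := by
    refine csInf_le' ⟨range F, ?_, rfl⟩
    refine TopologicalSpace.isTopologicalBasis_of_isOpen_of_nhds ?_ ?_
    · rintro _ ⟨p, rfl⟩
      exact isOpen_interior
    · intro y W hy hW
      obtain ⟨E, hE, hEW⟩ := UniformSpace.mem_nhds_iff.1 (hW.mem_nhds hy)
      obtain ⟨V, hV, hVs, hVE⟩ := comp_symm_mem_uniformity_sets hE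
      obtain ⟨s, hs, hsV⟩ := hbase V hV
      have hs' := hmem s hs
      obtain ⟨Q, ⟨hQ, hQo⟩, hQs⟩ := uniformity_hasBasis_open.mem_iff.1 hs'
      have hQy : {z | (z, y) ∈ Q} ∈ 𝓝 y := mem_nhds_right y hQ
      obtain ⟨d, hd⟩ := he.exists_mem_open
        (isOpen_interior (s := {z | (z, y) ∈ Q})) ⟨y, mem_interior_iff_mem_nhds.2 hQy⟩
      have hdy : (e d, y) ∈ Q := interior_subset (s := {z | (z, y) ∈ Q}) hd
      have hop : IsOpen {z | (e d, z) ∈ Q} := hQo.preimage (by fun_prop : Continuous fun z => (e d, z))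
      refine ⟨_, ⟨(⟨s, hs⟩, d), rfl⟩, ?_, ?_⟩
      · exact interior_maximal (s := {z | (e d, z) ∈ s}) (fun z hz => hQs hz) hop hdy
      · intro z hz
        have hz' : (e d, z) ∈ s := interior_subset (s := {z | (e d, z) ∈ s}) hz
        exact hEW (hVE ⟨e d, SetRel.symm V (hsV (hQs hdy)), hsV hz'⟩)
  refine hle.trans (mk_range_le.trans ?_)
  rw [mk_prod, lift_id, lift_id]
  exact (mul_le_mul' hS hD).trans (mul_eq_self hτ).le

/-! ### Completions of equiuniformities -/

/-- Near `(g, y)`, write `h • z = (h * g⁻¹) • (g • z)`: continuity of `g` handles the inner point,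
and boundedness handles `h * g⁻¹`, which is near the unit. -/
theorem continuousSMul_of_isBoundedAction {G Y : Type u} [Group G] [TopologicalSpace G]
    [IsTopologicalGroup G] [𝔙 : UniformSpace Y] [MulAction G Y] [UniformContinuousConstSMul G Y]
    (hb : IsBoundedAction G 𝔙) : ContinuousSMul G Y where
  continuous_smul := by
    rw [continuous_iff_continuousAt]
    rintro ⟨g, y⟩
    rw [ContinuousAt, Uniform.tendsto_nhds_right]
    intro W hW
    obtain ⟨V, hV, hVW⟩ := comp_mem_uniformity_sets hW
    obtain ⟨O, hO, hOV⟩ := hb V hV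
    have h1 : ∀ᶠ p : G × Y in 𝓝 (g, y), p.1 * g⁻¹ ∈ O := by
      have hc : Continuous fun p : G × Y => p.1 * g⁻¹ := by fun_prop
      exact hc.continuousAt.eventually (by simpa using hO)
    have h2 : ∀ᶠ p : G × Y in 𝓝 (g, y), (g • y, g • p.2) ∈ V := by
      have hc : Continuous fun p : G × Y => g • p.2 := by fun_prop
      exact hc.continuousAt.eventually (mem_nhds_left _ hV)
    rw [Filter.mem_map]
    filter_upwards [h1, h2] with p hp1 hp2
    refine hVW ⟨_, hp2, ?_⟩
    simpa [smul_smul] using hOV _ hp1 (g • p.2)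

theorem IsBoundedAction.completion {G X : Type u} [Group G] [TopologicalSpace G]
    [𝔘 : UniformSpace X] [MulAction G X] [UniformContinuousConstSMul G X]
    (hb : IsBoundedAction G 𝔘) :
    IsBoundedAction G (inferInstance : UniformSpace (UniformSpace.Completion X)) := by
  intro W hW
  obtain ⟨W', ⟨hW', hWc⟩, hWW⟩ := uniformity_hasBasis_closed.mem_iff.1 hW
  obtain ⟨O, hO, hOE⟩ := hb _ (UniformSpace.Completion.uniformContinuous_coe X hW')
  refine ⟨O, hO, fun g hg x => hWW ?_⟩
  induction x using UniformSpace.Completion.induction_on with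
  | hp => exact hWc.preimage (continuous_id.prodMk (continuous_const_smul g))
  | ih a => simpa [UniformSpace.Completion.coe_smul] using hOE g hg a

theorem exists_complete_extension {G X : Type u} [Group G] [TopologicalSpace G]
    [IsTopologicalGroup G] [t : TopologicalSpace X] [T0Space X] [MulAction G X]
    (𝔘 : UniformSpace X) (ht : 𝔘.toTopologicalSpace = t)
    (huc : ∀ g : G, @UniformContinuous X X 𝔘 𝔘 (fun x => g • x)) (hb : IsBoundedAction G 𝔘) :
    ∃ E : EquivariantExtension G X, ∃ 𝔙 : UniformSpace E.Y, IsEquiuniformity G 𝔙 ∧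
      @CompleteSpace E.Y 𝔙 ∧ 𝔘 = 𝔙.comap E.emb := by
  subst ht
  have : UniformContinuousConstSMul G X := ⟨huc⟩
  have hb' := hb.completion
  have : ContinuousSMul G (UniformSpace.Completion X) := continuousSMul_of_isBoundedAction hb'
  have : T35Space (UniformSpace.Completion X) := {}
  refine ⟨{ Y := UniformSpace.Completion X
            emb := (↑)
            isDenseEmbedding := UniformSpace.Completion.isDenseEmbedding_coe
            map_smul := UniformSpace.Completion.coe_smul },
    (inferInstance : UniformSpace (UniformSpace.Completion X)), ?_, ?_, ?_⟩
  · exact isEquiuniformity_of_uniformContinuous _ rfl (fun g => uniformContinuous_const_smul g) hb'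
  · exact (inferInstance : CompleteSpace (UniformSpace.Completion X))
  · exact (UniformSpace.Completion.isUniformInducing_coe X).comap_uniformSpace.symm

/-! ### Small families of neighborhoods of the unit -/

/-- Iterate the closure step `ω` times; no stage exceeds `τ`, since `τ * τ = τ`. -/
theorem exists_small_closed_superset {α : Type u} {τ : Cardinal.{u}} (hτ : ℵ₀ ≤ τ)
    (Γ : α → α → Set α) (hΓ : ∀ a b, #(Γ a b) ≤ τ) (S₀ : Set α) (h₀ : #S₀ ≤ τ) :
    ∃ S : Set α, S₀ ⊆ S ∧ #S ≤ τ ∧ ∀ a ∈ S, ∀ b ∈ S, Γ a b ⊆ S := by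
  let T : ℕ → Set α := fun n => Nat.rec (motive := fun _ => Set α) S₀
    (fun _ A => A ∪ ⋃ p : ↥A × ↥A, Γ p.1 p.2) n
  have hsucc : ∀ n, T (n + 1) = T n ∪ ⋃ p : ↥(T n) × ↥(T n), Γ p.1 p.2 := fun n => rfl
  have hmono : Monotone T := monotone_nat_of_le_succ fun n => by
    rw [hsucc]; exact subset_union_left
  have hcard : ∀ n, #(T n) ≤ τ := by
    intro n
    induction n with
    | zero => exact h₀
    | succ n ih =>
      rw [hsucc]
      refine (mk_union_le _ _).trans (add_le_of_le hτ ih ((mk_iUnion_le _).trans ?_))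
      refine mul_le_of_le hτ ?_ (ciSup_le' fun p => hΓ _ _)
      simpa using mul_le_of_le hτ ih ih
  refine ⟨⋃ n, T n, subset_iUnion T 0, ?_, ?_⟩
  · have h := mk_iUnion_le_lift T
    rw [lift_uzero] at h
    refine h.trans (mul_le_of_le hτ (by simpa using hτ) (ciSup_le' fun n => ?_))
    simpa using hcard n
  · intro a ha b hb c hc
    obtain ⟨m, hm⟩ := mem_iUnion.1 ha
    obtain ⟨n, hn⟩ := mem_iUnion.1 hb
    refine mem_iUnion.2 ⟨max m n + 1, ?_⟩
    rw [hsucc]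
    exact Or.inr (mem_iUnion.2 ⟨(⟨a, hmono (le_max_left m n) hm⟩, ⟨b, hmono (le_max_right m n) hn⟩), hc⟩)

theorem exists_symm_mul_subset {G : Type u} [Group G] [TopologicalSpace G] [IsTopologicalGroup G]
    {U : Set G} (hU : U ∈ 𝓝 (1 : G)) :
    ∃ V ∈ 𝓝 (1 : G), (∀ g ∈ V, g⁻¹ ∈ V) ∧ ∀ g ∈ V, ∀ h ∈ V, g * h ∈ U := by
  obtain ⟨W, hW, hWU⟩ := exists_nhds_one_split hU
  refine ⟨W ∩ W⁻¹, inter_mem hW (inv_mem_nhds_one G hW), fun g hg => ?_, fun g hg h hh =>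
    hWU g hg.1 h hh.1⟩
  exact ⟨hg.2, by simpa using hg.1⟩

/-- The conjugates `f W f⁻¹` with `f ∈ F` suffice: if `g⁻¹ = f w`, then conjugation by `g` sends `f
W f⁻¹` into `w⁻¹ W w`. -/
theorem IsNarrow.isBalanced {τ : Cardinal.{u}} {G : Type u} [Group G] [TopologicalSpace G]
    [IsTopologicalGroup G] (h : IsNarrow τ G) : IsBalanced τ G := by
  intro U hU
  obtain ⟨V, hV, -, hVU⟩ := exists_symm_mul_subset hU
  obtain ⟨W, hW, hWs, hWV⟩ := exists_symm_mul_subset hV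
  obtain ⟨F, hF, hFW⟩ := h W hW
  refine ⟨(fun f => {x | f⁻¹ * x * f ∈ W}) '' F, mk_image_le.trans hF, ?_, fun g => ?_⟩
  · rintro _ ⟨f, -, rfl⟩
    have hc : Continuous fun x : G => f⁻¹ * x * f := by fun_prop
    exact hc.continuousAt (x := 1) (by simpa using hW)
  · obtain ⟨f, hf, w, hw, hfw⟩ := hFW g⁻¹
    refine ⟨_, ⟨f, hf, rfl⟩, fun x hx => ?_⟩
    have hg : g = w⁻¹ * f⁻¹ := by rw [← mul_inv_rev, hfw, inv_inv]
    have : g * x * g⁻¹ = (w⁻¹ * (f⁻¹ * x * f)) * w := by rw [hg]; group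
    rw [this]
    refine hVU _ (hWV _ (hWs _ hw) _ hx) _ ?_
    simpa using hWV w hw 1 (mem_of_mem_nhds hW)

/-! ### Characters and weights -/

theorem exists_nhds_base {τ : Cardinal.{u}} {X : Type u} [TopologicalSpace X]
    (h : character X ≤ τ) (x : X) :
    ∃ B : Set (Set X), #B ≤ τ ∧ (𝓝 x).HasBasis (fun V => V ∈ B) id := by
  have hx : characterAt x ≤ τ := (le_ciSup bddAbove_of_small x).trans h
  have hne : {κ | ∃ B : Set (Set X), (𝓝 x).HasBasis (fun V => V ∈ B) id ∧ #B = κ}.Nonempty :=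
    ⟨_, {V | V ∈ 𝓝 x}, (𝓝 x).basis_sets, rfl⟩
  obtain ⟨B, hB, hBc⟩ := csInf_mem hne
  exact ⟨B, hBc.le.trans hx, hB⟩

theorem exists_isTopologicalBasis {τ : Cardinal.{u}} {X : Type u} [TopologicalSpace X]
    (h : weight X ≤ τ) :
    ∃ B : Set (Set X), #B ≤ τ ∧ TopologicalSpace.IsTopologicalBasis B := by
  have hne : {κ | ∃ B : Set (Set X), TopologicalSpace.IsTopologicalBasis B ∧ #B = κ}.Nonempty :=
    ⟨_, _, TopologicalSpace.isTopologicalBasis_opens, rfl⟩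
  obtain ⟨B, hB, hBc⟩ := csInf_mem hne
  exact ⟨B, hBc.le.trans h, hB⟩

theorem character_le_of_weight_le {τ : Cardinal.{u}} {X : Type u} [TopologicalSpace X]
    (h : weight X ≤ τ) : character X ≤ τ := by
  obtain ⟨B, hBc, hB⟩ := exists_isTopologicalBasis h
  refine ciSup_le' fun x => ?_
  have : characterAt x ≤ #{V | V ∈ B ∧ x ∈ V} := csInf_le' ⟨_, hB.nhds_hasBasis, rfl⟩
  exact this.trans ((mk_le_mk_of_subset fun V hV => hV.1).trans hBc)

theorem exists_dense_of_weight_le {τ : Cardinal.{u}} {X : Type u} [TopologicalSpace X]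
    (h : weight X ≤ τ) : ∃ D : Set X, #D ≤ τ ∧ Dense D := by
  obtain ⟨B, hBc, hB⟩ := exists_isTopologicalBasis h
  let f : {V : B // V.1.Nonempty} → X := fun V => V.2.some
  refine ⟨range f, (mk_range_le.trans (mk_subtype_le _)).trans hBc, hB.dense_iff.2 ?_⟩
  intro V hV hne
  exact ⟨_, hne.some_mem, ⟨⟨V, hV⟩, hne⟩, rfl⟩

/-! ### Equiuniformities of transitive `d`-open actions -/

theorem IsCosetSpace.isPretransitive {G X : Type u} [Group G] [TopologicalSpace G]
    [TopologicalSpace X] [MulAction G X] (h : IsCosetSpace G X) :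
    MulAction.IsPretransitive G X := by
  obtain ⟨K, -, e, he⟩ := h
  refine ⟨fun x y => ?_⟩
  obtain ⟨g, hg⟩ := MulAction.exists_smul_eq G (e x) (e y)
  exact ⟨g, e.injective (by rw [he, hg])⟩

theorem IsCosetSpace.isDOpenAction {G X : Type u} [Group G] [TopologicalSpace G]
    [IsTopologicalGroup G] [TopologicalSpace X] [MulAction G X] (h : IsCosetSpace G X) :
    IsDOpenAction G X := by
  obtain ⟨K, -, e, he⟩ := h
  intro x O hO
  rw [mem_interior_iff_mem_nhds]
  refine mem_of_superset ?_ subset_closure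
  obtain ⟨k, hk⟩ := QuotientGroup.mk_surjective (e x)
  have heq : (fun g : G => g • x) = e.symm ∘ (QuotientGroup.mk : G → G ⧸ K) ∘ fun g => g * k := by
    funext g
    simp only [Function.comp]
    rw [Homeomorph.eq_symm_apply, he, ← hk]
    rfl
  have hop : IsOpenMap fun g : G => g • x := by
    rw [heq]
    exact e.symm.isOpenMap.comp (QuotientGroup.isOpenMap_coe.comp (isOpenMap_mul_right k))
  simpa using hop.image_mem_nhds hO

/-- The pairs `(x, y)` for which `y` lies in the closure of `O x`. -/
def orbitEntourage {G : Type u} (X : Type u) [Group G] [TopologicalSpace X] [MulAction G X]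
    (O : Set G) : Set (X × X) :=
  {p | p.2 ∈ closure ((fun g : G => g • p.1) '' O)}

section

variable {G X : Type u} [Group G] [TopologicalSpace X] [MulAction G X]

theorem orbitEntourage_mono {O O' : Set G} (h : O ⊆ O') :
    orbitEntourage X O ⊆ orbitEntourage X O' :=
  fun _ hp => closure_mono (image_mono h) hp

theorem smul_mem_orbitEntourage {O : Set G} {g : G} (hg : g ∈ O) (x : X) :
    (x, g • x) ∈ orbitEntourage X O :=
  subset_closure ⟨g, hg, rfl⟩

variable [TopologicalSpace G] [ContinuousSMul G X]

theorem orbitEntourage_conj {O V : Set G} {g : G} (h : ∀ v ∈ V, g * v * g⁻¹ ∈ O) {x y : X}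
    (hxy : (x, y) ∈ orbitEntourage X V) : (g • x, g • y) ∈ orbitEntourage X O := by
  change g • y ∈ closure _
  refine map_mem_closure (continuous_const_smul g) (show y ∈ closure _ from hxy) ?_
  rintro _ ⟨v, hv, rfl⟩
  exact ⟨g * v * g⁻¹, h v hv, by simp [mul_smul]⟩

theorem orbitEntourage_comp {O V : Set G} (h : ∀ v ∈ V, ∀ w ∈ V, v * w ∈ O) {x y z : X}
    (hxy : (x, y) ∈ orbitEntourage X V) (hyz : (y, z) ∈ orbitEntourage X V) :
    (x, z) ∈ orbitEntourage X O := by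
  refine closure_minimal ?_ isClosed_closure hyz
  rintro _ ⟨v, hv, rfl⟩
  refine map_mem_closure (continuous_const_smul v) hxy ?_
  rintro _ ⟨w, hw, rfl⟩
  exact ⟨v * w, h v hv w hw, mul_smul _ _ _⟩

/-- As `cl (V y)` is a neighborhood of `y ∈ cl (V x)`, it contains some `v • x`; hence `x ∈ v⁻¹ cl
(V y) ⊆ cl (O y)`. -/
theorem orbitEntourage_symm (hd : IsDOpenAction G X) {O V : Set G} (hV : V ∈ 𝓝 (1 : G))
    (hs : ∀ v ∈ V, v⁻¹ ∈ V) (h : ∀ v ∈ V, ∀ w ∈ V, v * w ∈ O) {x y : X}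
    (hxy : (x, y) ∈ orbitEntourage X V) : (y, x) ∈ orbitEntourage X O := by
  obtain ⟨_, hz, v, hv, rfl⟩ := mem_closure_iff_nhds.1 hxy _
    (mem_interior_iff_mem_nhds.1 (hd y V hV))
  have hx : x = v⁻¹ • v • x := by simp
  change x ∈ closure _
  rw [hx]
  refine map_mem_closure (continuous_const_smul v⁻¹) hz ?_
  rintro _ ⟨w, hw, rfl⟩
  exact ⟨v⁻¹ * w, h _ (hs v hv) w hw, mul_smul _ _ _⟩

theorem exists_orbitEntourage_subset [RegularSpace X] {x : X} {W : Set X} (hW : W ∈ 𝓝 x) :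
    ∃ O ∈ 𝓝 (1 : G), {y | (x, y) ∈ orbitEntourage X O} ⊆ W := by
  obtain ⟨C, ⟨hC, hCc⟩, hCW⟩ := (closed_nhds_basis x).mem_iff.1 hW
  have hc : Continuous fun g : G => g • x := by fun_prop
  refine ⟨_, hc.continuousAt (x := 1) (by simpa using hC), fun y hy => hCW ?_⟩
  refine closure_minimal ?_ hCc hy
  rintro _ ⟨g, hg, rfl⟩
  exact hg

theorem exists_small_equiuniformity [IsTopologicalGroup G] [RegularSpace X]
    [MulAction.IsPretransitive G X] (hd : IsDOpenAction G X) {τ : Cardinal.{u}} (hτ : ℵ₀ ≤ τ)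
    (hG : IsBalanced τ G) (hX : character X ≤ τ) :
    ∃ 𝔘 : UniformSpace X, 𝔘.toTopologicalSpace = ‹TopologicalSpace X› ∧
      (∀ g : G, @UniformContinuous X X 𝔘 𝔘 (fun x => g • x)) ∧ IsBoundedAction G 𝔘 ∧
      HasSmallBase τ 𝔘 := by
  -- The seed family: its entourages give a base at a single `x₀`. For empty `X` the member `univ`
  -- keeps the family nonempty.
  have hS₀ : ∃ S₀ : Set {U : Set G // U ∈ 𝓝 (1 : G)}, #S₀ ≤ τ ∧ S₀.Nonempty ∧
      ∀ x : X, ∃ x₀ ∈ MulAction.orbit G x, ∀ W ∈ 𝓝 x₀, ∃ O ∈ S₀,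
        {y | (x₀, y) ∈ orbitEntourage X O.1} ⊆ W := by
    obtain hX0 | ⟨⟨x₀⟩⟩ := isEmpty_or_nonempty X
    · exact ⟨{⟨univ, univ_mem⟩}, by simpa using one_le_aleph0.trans hτ, singleton_nonempty _,
        fun x => isEmptyElim x⟩
    · obtain ⟨B, hBc, hB⟩ := exists_nhds_base hX x₀
      have hO : ∀ V : B, ∃ O : {U : Set G // U ∈ 𝓝 (1 : G)},
          {y | (x₀, y) ∈ orbitEntourage X O.1} ⊆ V.1 := fun V => by
        obtain ⟨O, hO, h⟩ := exists_orbitEntourage_subset (G := G) (hB.mem_of_mem V.2)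
        exact ⟨⟨O, hO⟩, h⟩
      choose O hO using hO
      obtain ⟨V, hV⟩ := hB.ex_mem
      refine ⟨range O, mk_range_le.trans hBc, ⟨_, ⟨V, hV⟩, rfl⟩, fun x =>
        ⟨x₀, MulAction.exists_smul_eq G x x₀, fun W hW => ?_⟩⟩
      obtain ⟨V, hV, hVW⟩ := hB.mem_iff.1 hW
      exact ⟨_, ⟨⟨V, hV⟩, rfl⟩, (hO ⟨V, hV⟩).trans hVW⟩
  obtain ⟨S₀, hS₀c, hS₀n, hS₀⟩ := hS₀
  have hroot : ∀ U V : {U : Set G // U ∈ 𝓝 (1 : G)}, ∃ A : {U : Set G // U ∈ 𝓝 (1 : G)},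
      (∀ g ∈ A.1, g⁻¹ ∈ A.1) ∧ ∀ g ∈ A.1, ∀ h ∈ A.1, g * h ∈ U.1 ∩ V.1 := fun U V => by
    obtain ⟨A, hA, h⟩ := exists_symm_mul_subset (inter_mem U.2 V.2)
    exact ⟨⟨A, hA⟩, h⟩
  choose A hAs hAm using hroot
  have hbal : ∀ U : {U : Set G // U ∈ 𝓝 (1 : G)}, ∃ γ : Set {U : Set G // U ∈ 𝓝 (1 : G)},
      #γ ≤ τ ∧ ∀ g : G, ∃ V ∈ γ, ∀ h ∈ V.1, g * h * g⁻¹ ∈ U.1 := fun U => by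
    obtain ⟨γ, hγ, hγn, h⟩ := hG U.1 U.2
    refine ⟨range fun V : γ => ⟨V.1, hγn V.1 V.2⟩, mk_range_le.trans hγ, fun g => ?_⟩
    obtain ⟨V, hV, hgV⟩ := h g
    exact ⟨_, ⟨⟨V, hV⟩, rfl⟩, hgV⟩
  choose γ hγc hγ using hbal
  obtain ⟨S, hS₀S, hSc, hS⟩ := exists_small_closed_superset hτ (fun U V => insert (A U V) (γ U))
    (fun U V => (mk_insert_le).trans
      (add_le_of_le hτ (hγc U) (one_le_aleph0.trans hτ))) S₀ hS₀c
  have hAS : ∀ U ∈ S, ∀ V ∈ S, A U V ∈ S := fun U hU V hV => hS U hU V hV (mem_insert _ _)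
  have hγS : ∀ U ∈ S, ∀ g : G, ∃ V ∈ S, ∀ h ∈ V.1, g * h * g⁻¹ ∈ U.1 := fun U hU g => by
    obtain ⟨V, hV, h⟩ := hγ U g
    exact ⟨V, hS U hU U hU (mem_insert_of_mem _ hV), h⟩
  let B : FilterBasis (X × X) :=
    { sets := (fun U => orbitEntourage X U.1) '' S
      nonempty := (hS₀n.mono hS₀S).image _
      inter_sets := by
        rintro _ _ ⟨U, hU, rfl⟩ ⟨V, hV, rfl⟩
        have h1 : (A U V).1 ⊆ U.1 ∩ V.1 := fun g hg => by
          simpa using hAm U V g hg 1 (mem_of_mem_nhds (A U V).2)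
        exact ⟨_, ⟨_, hAS U hU V hV, rfl⟩, subset_inter
          (orbitEntourage_mono (h1.trans inter_subset_left))
          (orbitEntourage_mono (h1.trans inter_subset_right))⟩ }
  have hrefl : ∀ r ∈ B, ∀ x, (x, x) ∈ r := by
    rintro _ ⟨U, -, rfl⟩ x
    simpa using smul_mem_orbitEntourage (mem_of_mem_nhds U.2) x
  have hsymm : ∀ r ∈ B, ∃ t ∈ B, t ⊆ Prod.swap ⁻¹' r := by
    rintro _ ⟨U, hU, rfl⟩
    exact ⟨_, ⟨_, hAS U hU U hU, rfl⟩, fun p hp => orbitEntourage_symm hd (A U U).2 (hAs U U)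
      (fun v hv w hw => (hAm U U v hv w hw).1) hp⟩
  have hcomp : ∀ r ∈ B, ∃ t ∈ B, SetRel.comp t t ⊆ r := by
    rintro _ ⟨U, hU, rfl⟩
    refine ⟨_, ⟨_, hAS U hU U hU, rfl⟩, ?_⟩
    rintro ⟨x, z⟩ ⟨y, hxy, hyz⟩
    exact orbitEntourage_comp (fun v hv w hw => (hAm U U v hv w hw).1) hxy hyz
  let 𝔘 : UniformSpace X := UniformSpace.ofCore (UniformSpace.Core.mkOfBasis B hrefl hsymm hcomp)
  have hbase : ∀ E : Set (X × X), E ∈ 𝔘.uniformity ↔ ∃ U ∈ S, orbitEntourage X U.1 ⊆ E := by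
    intro E
    refine B.mem_filter_iff.trans ⟨?_, ?_⟩
    · rintro ⟨_, ⟨U, hU, rfl⟩, h⟩
      exact ⟨U, hU, h⟩
    · rintro ⟨U, hU, h⟩
      exact ⟨_, ⟨U, hU, rfl⟩, h⟩
  refine ⟨𝔘, ?_, fun g E hE => ?_, fun E hE => ?_, ?_⟩
  · refine TopologicalSpace.ext_nhds fun x => ?_
    rw [𝔘.nhds_eq_comap_uniformity]
    ext W
    rw [mem_comap]
    constructor
    · rintro ⟨E, hE, hEW⟩
      obtain ⟨U, hU, hUE⟩ := (hbase E).1 hE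
      exact mem_of_superset (mem_interior_iff_mem_nhds.1 (hd x U.1 U.2)) fun y hy => hEW (hUE hy)
    · intro hW
      obtain ⟨_, ⟨g, rfl⟩, h⟩ := hS₀ x
      -- Move `W` to the base point `g • x`, then return through a `V ∈ S` with `g V g⁻¹ ⊆ U`.
      have hW' : (fun y : X => g⁻¹ • y) ⁻¹' W ∈ 𝓝 (g • x) :=
        (continuous_const_smul g⁻¹).continuousAt (by simpa using hW)
      obtain ⟨U, hU, hUW⟩ := h _ hW'
      obtain ⟨V, hV, hVU⟩ := hγS U (hS₀S hU) g
      refine ⟨_, (hbase _).2 ⟨V, hV, Subset.rfl⟩, fun y hy => ?_⟩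
      simpa using hUW (orbitEntourage_conj hVU hy)
  · obtain ⟨U, hU, hUE⟩ := (hbase E).1 hE
    obtain ⟨V, hV, hVU⟩ := hγS U hU g
    exact (hbase _).2 ⟨V, hV, fun p hp => hUE (orbitEntourage_conj hVU hp)⟩
  · obtain ⟨U, hU, hUE⟩ := (hbase E).1 hE
    exact ⟨U.1, U.2, fun g hg x => hUE (smul_mem_orbitEntourage hg x)⟩
  · refine ⟨(fun U => orbitEntourage X U.1) '' S, mk_image_le.trans hSc, ?_, fun E hE => ?_⟩
    · rintro _ ⟨U, hU, rfl⟩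
      exact (hbase _).2 ⟨U, hU, Subset.rfl⟩
    · obtain ⟨U, hU, hUE⟩ := (hbase E).1 hE
      exact ⟨_, ⟨U, hU, rfl⟩, hUE⟩

end

/-! ### Totally bounded equiuniformities of narrow groups -/

theorem isBoundedAction_iff_tendsto {G X : Type u} [Group G] [TopologicalSpace G]
    [MulAction G X] {𝔘 : UniformSpace X} :
    IsBoundedAction G 𝔘 ↔
      Tendsto (fun p : G × X => (p.2, p.1 • p.2)) (𝓝 1 ×ˢ ⊤) 𝔘.uniformity := by
  refine forall₂_congr fun E _ => ?_
  rw [mem_map, mem_prod_top]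
  exact ⟨fun ⟨O, hO, h⟩ => mem_of_superset hO h, fun h => ⟨_, h, fun g hg x => hg x⟩⟩

/-- A uniformly continuous function whose translates separate points from closed sets. -/
theorem exists_uniformContinuous_separating (G : Type u) {X : Type u} [Group G] [MulAction G X]
    [𝔘 : UniformSpace X] [IsCountablyGenerated (𝓤 X)] [MulAction.IsPretransitive G X]
    [ContinuousConstSMul G X] :
    ∃ f : X → Icc (0 : ℝ) 1, UniformContinuous f ∧
      ∀ x : X, ∀ W ∈ 𝓝 x, ∃ g : G, ∃ V ∈ 𝓝 (f (g • x)), ∀ y, f (g • y) ∈ V → y ∈ W := by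
  obtain hX | ⟨⟨x₀⟩⟩ := isEmpty_or_nonempty X
  · exact ⟨fun _ => 0, uniformContinuous_const, fun x => isEmptyElim x⟩
  let := UniformSpace.pseudoMetricSpace X
  let f : X → Icc (0 : ℝ) 1 := fun x => projIcc 0 1 zero_le_one (dist x x₀)
  refine ⟨f, (LipschitzWith.projIcc zero_le_one).uniformContinuous.comp
    (uniformContinuous_id.dist uniformContinuous_const), fun x W hW => ?_⟩
  obtain ⟨g, rfl⟩ := MulAction.exists_smul_eq G x₀ x
  have hW' : (fun y : X => g • y) ⁻¹' W ∈ 𝓝 x₀ := (continuous_const_smul g).continuousAt hW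
  obtain ⟨ε, hε, h⟩ := Metric.mem_nhds_iff.1 hW'
  -- Below `1` the truncation is inactive, so the bound `min 1 ε` controls the true distance.
  refine ⟨g⁻¹, {t | (t : ℝ) < min 1 ε}, ?_, fun y hy => ?_⟩
  · refine (isOpen_lt continuous_subtype_val continuous_const).mem_nhds ?_
    simp [f, hε]
  · have hy' : dist (g⁻¹ • y) x₀ < ε := by
      have h1 : max 0 (min 1 (dist (g⁻¹ • y) x₀)) < min 1 ε := hy
      have h2 := (le_max_right _ _).trans_lt h1
      rcases min_lt_iff.1 h2 with h3 | h3
      · exact absurd (h3.trans_le (min_le_left _ _)) (lt_irrefl _)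
      · exact h3.trans_le (min_le_right _ _)
    simpa using h hy'

theorem exists_countable_dense_translates {G X : Type u} [Group G] [TopologicalSpace G]
    [IsTopologicalGroup G] [𝔘 : UniformSpace X] [MulAction G X] (hG : IsNarrow ℵ₀ G)
    (hb : IsBoundedAction G 𝔘) {Z : Type*} [PseudoMetricSpace Z] {f : X → Z}
    (hf : UniformContinuous f) :
    ∃ C : Set G, C.Countable ∧
      ∀ ε > 0, ∀ g : G, ∃ c ∈ C, ∀ x, dist (f (g • x)) (f (c • x)) < ε := by
  have h : ∀ n : ℕ, ∃ F : Set G, F.Countable ∧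
      ∀ g : G, ∃ c ∈ F, ∀ x, dist (f (g • x)) (f (c • x)) < 1 / ((n : ℝ) + 1) := by
    intro n
    obtain ⟨O, hO, hOf⟩ := hb _ (hf (Metric.dist_mem_uniformity (Nat.one_div_pos_of_nat (n := n))))
    -- Narrowness is applied to `g⁻¹` and `O⁻¹`, so that `g = o⁻¹ * c⁻¹` has its small factor on the
    -- left, where boundedness applies.
    obtain ⟨F, hF, hFO⟩ := hG O⁻¹ (inv_mem_nhds_one G hO)
    refine ⟨(·⁻¹) '' F, (le_aleph0_iff_set_countable.1 hF).image _, fun g => ?_⟩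
    obtain ⟨c, hc, o, ho, hco⟩ := hFO g⁻¹
    refine ⟨c⁻¹, ⟨c, hc, rfl⟩, fun x => ?_⟩
    have hg : g = o⁻¹ * c⁻¹ := by rw [← mul_inv_rev, hco, inv_inv]
    have := hOf o⁻¹ ho (c⁻¹ • x)
    rw [hg, mul_smul, dist_comm]
    exact this
  choose F hF hFd using h
  refine ⟨⋃ n, F n, countable_iUnion hF, fun ε hε g => ?_⟩
  obtain ⟨n, hn⟩ := exists_nat_one_div_lt hε
  obtain ⟨c, hc, h⟩ := hFd n g
  exact ⟨c, mem_iUnion.2 ⟨n, hc⟩, fun x => (h x).trans hn⟩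

theorem exists_totallyBounded_equiuniformity {G X : Type u} [Group G] [TopologicalSpace G]
    [IsTopologicalGroup G] [t : TopologicalSpace X] [MulAction G X] [ContinuousConstSMul G X]
    [MulAction.IsPretransitive G X] (hG : IsNarrow ℵ₀ G) (𝔘 : UniformSpace X)
    (ht : 𝔘.toTopologicalSpace = t)
    (huc : ∀ g : G, @UniformContinuous X X 𝔘 𝔘 (fun x => g • x)) (hb : IsBoundedAction G 𝔘)
    (hbase : HasSmallBase ℵ₀ 𝔘) :
    ∃ 𝔚 : UniformSpace X, 𝔚.toTopologicalSpace = t ∧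
      (∀ g : G, @UniformContinuous X X 𝔚 𝔚 (fun x => g • x)) ∧ IsBoundedAction G 𝔚 ∧
      HasSmallBase ℵ₀ 𝔚 ∧ @TotallyBounded X 𝔚 univ := by
  subst ht
  have := hbase.isCountablyGenerated
  obtain ⟨f, hf, hsep⟩ := exists_uniformContinuous_separating G (X := X)
  obtain ⟨C, hC, hCd⟩ := exists_countable_dense_translates hG hb hf
  let F : X → G → Icc (0 : ℝ) 1 := fun x g => f (g • x)
  let F' : X → C → Icc (0 : ℝ) 1 := fun x c => f (c.1 • x)
  have hind : 𝔘.toTopologicalSpace ≤ TopologicalSpace.induced F inferInstance :=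
    continuous_iff_le_induced.1
      (continuous_pi fun g => hf.continuous.comp (continuous_const_smul g))
  have hbt : ∀ g : G, Tendsto (fun p : G × X => (f (g • p.2), f (g • p.1 • p.2))) (𝓝 1 ×ˢ ⊤)
      (𝓤 (Icc (0 : ℝ) 1)) :=
    fun g => Tendsto.comp (hf.comp (huc g)) (isBoundedAction_iff_tendsto.1 hb)
  let 𝔚 : UniformSpace X := UniformSpace.comap F inferInstance
  have hF : @UniformContinuous _ _ 𝔚 _ F := uniformContinuous_comap
  have hFg : ∀ g, @UniformContinuous _ _ 𝔚 _ (fun x => f (g • x)) := fun g =>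
    (Pi.uniformContinuous_proj (fun _ : G => Icc (0 : ℝ) 1) g).comp hF
  -- Each coordinate is a uniform limit of coordinates from `C`, so the countable subproduct induces
  -- the same uniformity.
  have heq : 𝔚 = UniformSpace.comap F' inferInstance := by
    refine le_antisymm ?_ ?_
    · exact tendsto_iff_comap.1 (uniformContinuous_pi.2 fun c => hFg c.1)
    · let 𝔚' : UniformSpace X := UniformSpace.comap F' inferInstance
      have hF' : @UniformContinuous _ _ 𝔚' _ F' := uniformContinuous_comap
      refine tendsto_iff_comap.1 (uniformContinuous_pi.2 fun g => ?_)
      refine Metric.uniformity_basis_dist.tendsto_right_iff.2 fun ε hε => ?_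
      obtain ⟨c, hc, hcg⟩ := hCd (ε / 3) (by positivity) g
      have h1 : ∀ᶠ p : X × X in 𝔚'.uniformity, dist (f (c • p.1)) (f (c • p.2)) < ε / 3 :=
        ((Pi.uniformContinuous_proj _ (⟨c, hc⟩ : C)).comp hF')
          (Metric.dist_mem_uniformity (by positivity : 0 < ε / 3))
      filter_upwards [h1] with p hp
      have h2 := hcg p.1
      have h3 := hcg p.2
      rw [dist_comm] at h3
      have h4 := dist_triangle4 (f (g • p.1)) (f (c • p.1)) (f (c • p.2)) (f (g • p.2))
      change dist (f (g • p.1)) (f (g • p.2)) < ε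
      linarith
  refine ⟨𝔚, ?_, fun g => ?_, ?_, ?_, ?_⟩
  · refine TopologicalSpace.ext_nhds fun x => le_antisymm ?_ ?_
    · intro W hW
      obtain ⟨g, V, hV, h⟩ := hsep x W hW
      have hc : @ContinuousAt _ _ 𝔚.toTopologicalSpace _ (fun x => f (g • x)) x :=
        (@UniformContinuous.continuous _ _ 𝔚 _ _ (hFg g)).continuousAt
      exact mem_of_superset (hc hV) h
    · exact _root_.nhds_mono hind
  -- Translation by `g` permutes coordinates: `F (g • x) h = F x (h * g)`.
  · refine uniformContinuous_comap' ?_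
    refine uniformContinuous_pi.2 fun h => ?_
    simpa [F, Function.comp_def, smul_smul] using hFg (h * g)
  · rw [isBoundedAction_iff_tendsto]
    change Tendsto _ _ (comap _ (𝓤 (G → Icc (0 : ℝ) 1)))
    rw [tendsto_comap_iff, Pi.uniformity, tendsto_iInf]
    intro g
    rw [tendsto_comap_iff]
    exact hbt g
  · have : IsCountablyGenerated 𝔚.uniformity := by
      have := hC.to_subtype
      rw [heq]
      exact Filter.comap.isCountablyGenerated (𝓤 (C → Icc (0 : ℝ) 1)) _
    exact @HasSmallBase.of_isCountablyGenerated X 𝔚 this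
  · exact @totallyBounded_preimage _ _ 𝔚 _ F univ ⟨rfl⟩ isCompact_univ.totallyBounded

theorem compactSpace_of_totallyBounded_comap {X Y : Type*} [𝔙 : UniformSpace Y]
    [CompleteSpace Y] {e : X → Y} (he : DenseRange e)
    (h : @TotallyBounded X (𝔙.comap e) univ) : CompactSpace Y := by
  let := 𝔙.comap e
  have h1 : TotallyBounded (closure (e '' univ)) := (h.image uniformContinuous_comap).closure
  rw [image_univ, he.closure_range] at h1
  exact ⟨h1.isCompact_of_isClosed isClosed_univ⟩

end

end EquiUnif

theorem corollary3p21 (G X : Type u) [Group G] [TopologicalSpace G] [IsTopologicalGroup G]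
    [T2Space G] [TopologicalSpace X] [T35Space X] [MulAction G X] [ContinuousSMul G X]
    (hX : EquiUnif.IsCosetSpace G X ∨
      (MulAction.IsPretransitive G X ∧ EquiUnif.IsDOpenAction G X)) :
    (∀ τ : Cardinal.{u}, ℵ₀ ≤ τ → EquiUnif.IsBalanced τ G → EquiUnif.character X ≤ τ →
      ∃ 𝓤 : UniformSpace X, EquiUnif.IsEquiuniformity G 𝓤 ∧ EquiUnif.uniformWeight 𝓤 ≤ τ) ∧
    (∀ τ : Cardinal.{u}, ℵ₀ ≤ τ → EquiUnif.IsBalanced τ G → EquiUnif.weight X ≤ τ →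
      ∃ 𝓤 : UniformSpace X, EquiUnif.IsEquiuniformity G 𝓤 ∧ EquiUnif.uniformWeight 𝓤 ≤ τ ∧
        ∃ E : EquiUnif.EquivariantExtension G X, EquiUnif.weight E.Y ≤ τ ∧
          ∃ 𝓥 : UniformSpace E.Y, EquiUnif.IsEquiuniformity G 𝓥 ∧ @CompleteSpace E.Y 𝓥 ∧
            EquiUnif.uniformWeight 𝓥 ≤ τ ∧ 𝓤 = 𝓥.comap E.emb) ∧
    (EquiUnif.IsBalanced ℵ₀ G → EquiUnif.character X ≤ ℵ₀ →
      ∃ 𝓤 : UniformSpace X, EquiUnif.IsEquiuniformity G 𝓤 ∧ EquiUnif.uniformWeight 𝓤 ≤ ℵ₀ ∧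
        ∃ E : EquiUnif.EquivariantExtension G X, ∃ m : MetricSpace E.Y,
          m.toUniformSpace.toTopologicalSpace = E.top ∧
          @CompleteSpace E.Y m.toUniformSpace ∧ 𝓤 = m.toUniformSpace.comap E.emb) ∧
    (EquiUnif.IsNarrow ℵ₀ G → EquiUnif.character X ≤ ℵ₀ →
      ∃ 𝓤 : UniformSpace X, EquiUnif.IsEquiuniformity G 𝓤 ∧ EquiUnif.uniformWeight 𝓤 ≤ ℵ₀ ∧
        @TotallyBounded X 𝓤 Set.univ ∧
        ∃ E : EquiUnif.EquivariantExtension G X, CompactSpace E.Y ∧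
          TopologicalSpace.MetrizableSpace E.Y ∧
          ∃ 𝓥 : UniformSpace E.Y, 𝓥.toTopologicalSpace = E.top ∧ 𝓤 = 𝓥.comap E.emb) := by
  have htr : MulAction.IsPretransitive G X := hX.elim (fun h => h.isPretransitive) (fun h => h.1)
  have hd : EquiUnif.IsDOpenAction G X := hX.elim (fun h => h.isDOpenAction) (fun h => h.2)
  refine ⟨fun τ hτ hG hχ => ?_, fun τ hτ hG hw => ?_, fun hG hχ => ?_, fun hG hχ => ?_⟩
  · obtain ⟨𝔘, ht, huc, hb, hB⟩ := EquiUnif.exists_small_equiuniformity hd hτ hG hχ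
    exact ⟨𝔘, EquiUnif.isEquiuniformity_of_uniformContinuous 𝔘 ht huc hb, hB.uniformWeight_le⟩
  · obtain ⟨𝔘, ht, huc, hb, hB⟩ := EquiUnif.exists_small_equiuniformity hd hτ hG
      (EquiUnif.character_le_of_weight_le hw)
    obtain ⟨E, 𝔙, hE, hc, h⟩ := EquiUnif.exists_complete_extension 𝔘 ht huc hb
    have hdr : DenseRange E.emb := E.isDenseEmbedding.dense
    have hB' : EquiUnif.HasSmallBase τ 𝔙 := by
      -- The topology of `𝔙` equals that of `E` only propositionally, so density is transported
      -- along `htop`.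
      have htop := hE.compatible
      refine EquiUnif.HasSmallBase.of_comap (e := E.emb) ?_ (h ▸ hB)
      rwa [htop]
    refine ⟨𝔘, EquiUnif.isEquiuniformity_of_uniformContinuous 𝔘 ht huc hb, hB.uniformWeight_le,
      E, ?_, 𝔙, hE, hc, hB'.uniformWeight_le, h⟩
    obtain ⟨D, hDc, hD⟩ := EquiUnif.exists_dense_of_weight_le hw
    have hDE : DenseRange fun d : D => E.emb d :=
      hdr.comp hD.denseRange_val E.isDenseEmbedding.continuous
    have htop := hE.compatible
    rw [← htop] at hDE ⊢
    exact EquiUnif.weight_le_of_denseRange hτ hB' hDc hDE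
  · obtain ⟨𝔘, ht, huc, hb, hB⟩ := EquiUnif.exists_small_equiuniformity hd le_rfl hG hχ
    obtain ⟨E, 𝔙, hE, hc, h⟩ := EquiUnif.exists_complete_extension 𝔘 ht huc hb
    have htop := hE.compatible
    have hdr : DenseRange E.emb := E.isDenseEmbedding.dense
    have hT0 : T0Space E.Y := inferInstance
    rw [← htop] at hdr hT0
    have hcg := (EquiUnif.HasSmallBase.of_comap hdr (h ▸ hB)).isCountablyGenerated
    exact ⟨𝔘, EquiUnif.isEquiuniformity_of_uniformContinuous 𝔘 ht huc hb, hB.uniformWeight_le,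
      E, UniformSpace.metricSpace E.Y, htop, hc, h⟩
  · obtain ⟨𝔘₀, ht₀, huc₀, hb₀, hB₀⟩ :=
      EquiUnif.exists_small_equiuniformity hd le_rfl hG.isBalanced hχ
    obtain ⟨𝔘, ht, huc, hb, hB, htb⟩ :=
      EquiUnif.exists_totallyBounded_equiuniformity hG 𝔘₀ ht₀ huc₀ hb₀ hB₀
    obtain ⟨E, 𝔙, hE, hc, h⟩ := EquiUnif.exists_complete_extension 𝔘 ht huc hb
    have htop := hE.compatible
    have hdr : DenseRange E.emb := E.isDenseEmbedding.dense
    have hT0 : T0Space E.Y := inferInstance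
    rw [← htop] at hdr hT0
    have hcg := (EquiUnif.HasSmallBase.of_comap hdr (h ▸ hB)).isCountablyGenerated
    have hcomp := EquiUnif.compactSpace_of_totallyBounded_comap hdr (h ▸ htb)
    have hmet := @UniformSpace.metrizableSpace E.Y 𝔙 hcg hT0
    rw [htop] at hcomp hmet
    exact ⟨𝔘, EquiUnif.isEquiuniformity_of_uniformContinuous 𝔘 ht huc hb, hB.uniformWeight_le,
      htb, E, hcomp, hmet, 𝔙, htop, h⟩
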